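/- Let $k \ge 3$ be an integer and let $G$ be a finite simple $k$-regular graph with a fixed linear ordering of its edges. Put $$R(k) := 1+\left\lfloor \frac{k-1}{k-2}\,\bigl(2k^2-4k\bigr)^{1/(k-1)}\right\rfloor .$$ Suppose that each edge $e$ of $G$ is given a list $L_e$ of at least $R(k)$ labels. Then one can choose for each edge $e$ a label from $L_e$ such that for every two adjacent vertices $u$ and $v$ the sequences of labels on the edges incident to $u$ and on the edges incident to $v$, each read in the fixed ordering of the edges, are different. Moreover, $R(k) \le 3$ for all $k \ge 6$, and $R(k) = 2$ for all $k \ge 10$. -/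

import Mathlib

/-- The number `1 + ⌊(k - 1) / (k - 2) * (2k² - 4k)^(1 / (k - 1))⌋`, computed over the reals
(meaningful for `k ≥ 3`). -/
noncomputable def sequenceListBound (k : ℕ) : ℕ :=
  1 + ⌊((k : ℝ) - 1) / ((k : ℝ) - 2) *
    (2 * (k : ℝ) ^ 2 - 4 * (k : ℝ)) ^ (1 / ((k : ℝ) - 1))⌋₊

/-- The set `E(v)` of the edges of `G` that are incident to `v`. -/
noncomputable def incidentEdges {V : Type*} [Finite V] (G : SimpleGraph V) (v : V) :
    Finset G.edgeSet :=
  (Set.toFinite {e : G.edgeSet | v ∈ (e : Sym2 V)}).toFinset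

/-- The sequence of labels on the edges incident to `v`, read in the increasing order of these
edges in the given linear order of the edges of `G`. -/
noncomputable def labelSequence {V α : Type*} [Finite V] (G : SimpleGraph V)
    (ord : LinearOrder G.edgeSet) (c : G.edgeSet → α) (v : V) : List α :=
  ((incidentEdges G v).sort ord.le).map c

/-- The edge labeling `c` distinguishes neighbors by sequences. -/
def DistinguishesNeighborsBySequences {V α : Type*} [Finite V] (G : SimpleGraph V)
    (ord : LinearOrder G.edgeSet) (c : G.edgeSet → α) : Prop :=
  ∀ u v : V, G.Adj u v → labelSequence G ord c u ≠ labelSequence G ord c v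

/-! The proof is a counting induction in place of the local lemma. If `u` and `v` are adjacent with
equal sequences, then comparing them position by position, and skipping the position of `uv` at `u`,
gives `k - 1` disjoint monochromatic pairs of edges. These pairs form the system of the edge `uv`;
an edge lies in at most `m = 2k` systems.

Let `N(S)` count list labelings of all edges, with lists of size `r`, that break every system inside
`S`. The claim is `β * N(S) ≤ r * N(S ∪ {e})`: each new constrained edge keeps at least a fraction
`β / r` of the labelings (`mul_countBreaking_le`). A labeling lost at `e` has a monochromatic system
through `e`. Its labels on one end of each pair, `e` among them, are determined by the other ends,
and releasing those `k - 1` ends and applying induction bounds the loss per system by `N(S) / (r * β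
^ (k - 2))`. The claim follows when `β + m / β ^ (k - 2) ≤ r`; minimizing the left side over `β`
gives the expression inside the floor in `R(k)`. -/

section PairSystems

/-! ### Counting labelings that break systems of disjoint pairs -/

variable {E I ι α : Type*}

/-- The labeling `c` breaks at least one pair of each system of pairs `p f` contained in `S`. -/
def BreaksPairsWithin (p : I → ι ⊕ ι → E) (S : Finset E) (c : E → α) : Prop :=
  ∀ f, (∀ j, p f j ∈ S) → ∃ i, c (p f (.inl i)) ≠ c (p f (.inr i))

theorem BreaksPairsWithin.mono {p : I → ι ⊕ ι → E} {S T : Finset E} {c : E → α}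
    (h : BreaksPairsWithin p T c) (hST : S ⊆ T) : BreaksPairsWithin p S c :=
  fun f hf => h f fun j => hST (hf j)

theorem BreaksPairsWithin.congr {p : I → ι ⊕ ι → E} {S : Finset E} {c d : E → α}
    (h : BreaksPairsWithin p S c) (hcd : ∀ e ∈ S, c e = d e) : BreaksPairsWithin p S d := by
  intro f hf
  obtain ⟨i, hi⟩ := h f hf
  exact ⟨i, by rwa [← hcd _ (hf _), ← hcd _ (hf _)]⟩

open Classical in
/-- The number of list labelings that satisfy `BreaksPairsWithin p S`. -/
noncomputable def countBreaking [Fintype E] (L : E → Finset α) (p : I → ι ⊕ ι → E)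
    (S : Finset E) : ℕ :=
  ((Fintype.piFinset L).filter (BreaksPairsWithin p S)).card

open Classical in
-- Relabeling `a` freely is injective on pairs (labeling, new label), since the old label of `a` can
-- be read off at `b`.
theorem card_filter_eq_mul_le [Fintype E] {L : E → Finset α} {a b : E} (hab : a ≠ b)
    {Q : (E → α) → Prop} (hQ : ∀ c x, Q c → Q (Function.update c a x)) :
    ((Fintype.piFinset L).filter fun c => Q c ∧ c a = c b).card * (L a).card ≤
      ((Fintype.piFinset L).filter Q).card := by
  rw [← Finset.card_product]
  refine Finset.card_le_card_of_injOn (fun q => Function.update q.1 a q.2) ?_ ?_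
  · rintro ⟨c, x⟩ h
    simp only [Finset.coe_product, Set.mem_prod, Finset.mem_coe, Finset.mem_filter,
      Fintype.mem_piFinset] at h ⊢
    refine ⟨fun e => ?_, hQ _ _ h.1.2.1⟩
    by_cases he : e = a
    · subst he; simpa using h.2
    · simpa [he] using h.1.1 e
  · rintro ⟨c, x⟩ h ⟨d, y⟩ h' heq
    simp only [Finset.coe_product, Set.mem_prod, Finset.mem_coe, Finset.mem_filter,
      Fintype.mem_piFinset] at h h' heq
    have hne : ∀ e, e ≠ a → c e = d e := fun e he => by
      simpa [he] using congrFun heq e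
    have hx : x = y := by simpa using congrFun heq a
    have hc : c = d := by
      funext e
      by_cases he : e = a
      · rw [he, h.1.2.2, h'.1.2.2, hne b hab.symm]
      · exact hne e he
    rw [hx, hc]

open Classical in
theorem card_filter_forall_eq_mul_pow_le [Fintype E] {L : E → Finset α} {r : ℕ}
    (hL : ∀ e, (L e).card = r) {q : ι ⊕ ι → E} (hq : Function.Injective q)
    {Q : (E → α) → Prop} (hQ : ∀ c i x, Q c → Q (Function.update c (q (.inl i)) x))
    (s : Finset ι) :
    ((Fintype.piFinset L).filter
      fun c => Q c ∧ ∀ i ∈ s, c (q (.inl i)) = c (q (.inr i))).card * r ^ s.card ≤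
      ((Fintype.piFinset L).filter Q).card := by
  induction s using Finset.induction_on with
  | empty => simp
  | insert i s hi ih =>
    refine le_trans ?_ ih
    rw [Finset.card_insert_of_notMem hi, pow_succ', ← mul_assoc]
    refine Nat.mul_le_mul_right _ ?_
    have hstep := card_filter_eq_mul_le (L := L) (a := q (.inl i)) (b := q (.inr i))
      (fun h => by simpa using hq h)
      (Q := fun c => Q c ∧ ∀ i ∈ s, c (q (.inl i)) = c (q (.inr i))) (by
        rintro c x ⟨h1, h2⟩
        refine ⟨hQ _ _ _ h1, fun j hj => ?_⟩
        have hji : j ≠ i := fun h => hi (h ▸ hj)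
        rw [Function.update_of_ne (fun h => hji (by simpa using hq h)),
          Function.update_of_ne (fun h => by simpa using hq h)]
        exact h2 j hj)
    rw [hL] at hstep
    refine le_trans (Nat.mul_le_mul_right _ (Finset.card_le_card fun c => ?_))
      (hstep.trans (le_of_eq (by congr)))
    simp only [Finset.mem_filter, Finset.forall_mem_insert]
    tauto

open Classical in
/-- Few of the labelings counted by `countBreaking L p S` have all pairs of a given system through
a new element `e` monochromatic. -/
theorem card_breaking_forall_eq_mul_pow_le [Fintype E] [Fintype ι] {L : E → Finset α} {r : ℕ}
    (hL : ∀ e, (L e).card = r) (p : I → ι ⊕ ι → E) {q : ι ⊕ ι → E} (hq : Function.Injective q)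
    {S : Finset E} {e : E} (hqS : ∀ j, q j ∈ insert e S) {j₀ : ι ⊕ ι} (hj₀ : q j₀ = e) :
    ∃ A : Finset E, A ⊆ insert e S ∧ e ∈ A ∧ A.card = Fintype.card ι ∧
      ((Fintype.piFinset L).filter fun c => BreaksPairsWithin p S c ∧
        ∀ i, c (q (.inl i)) = c (q (.inr i))).card * r ^ Fintype.card ι ≤
        countBreaking L p (insert e S \ A) := by
  suffices H : ∀ q : ι ⊕ ι → E, Function.Injective q → (∀ j, q j ∈ insert e S) →
      ∀ i₀, q (.inl i₀) = e → ∃ A : Finset E, A ⊆ insert e S ∧ e ∈ A ∧ A.card = Fintype.card ι ∧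
      ((Fintype.piFinset L).filter fun c => BreaksPairsWithin p S c ∧
        ∀ i, c (q (.inl i)) = c (q (.inr i))).card * r ^ Fintype.card ι ≤
        countBreaking L p (insert e S \ A) by
    rcases j₀ with i₀ | i₀
    · exact H q hq hqS i₀ hj₀
    -- Exchanging `e` with its partner makes `e` a left end, so `A` can always be the set of left
    -- ends.
    · obtain ⟨A, h1, h2, h3, h4⟩ := H (q ∘ Equiv.swap (.inl i₀) (.inr i₀))
        (hq.comp (Equiv.injective _)) (fun j => hqS _) i₀ (by simpa using hj₀)
      refine ⟨A, h1, h2, h3, le_trans (le_of_eq ?_) h4⟩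
      congr 2
      ext c
      simp only [Finset.mem_filter, Function.comp]
      refine and_congr_right fun _ => and_congr_right fun _ => forall_congr' fun i => ?_
      by_cases hi : i = i₀
      · subst hi
        simpa using eq_comm
      · rw [Equiv.swap_apply_of_ne_of_ne (by simpa using hi) (by simp),
          Equiv.swap_apply_of_ne_of_ne (by simp) (by simpa using hi)]
  intro q hq hqS i₀ hi₀
  refine ⟨Finset.univ.image fun i => q (.inl i), ?_, ?_, ?_, ?_⟩
  · intro x hx
    obtain ⟨i, -, rfl⟩ := Finset.mem_image.1 hx
    exact hqS _
  · exact Finset.mem_image.2 ⟨i₀, Finset.mem_univ _, hi₀⟩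
  · exact Finset.card_image_of_injective _ (hq.comp Sum.inl_injective)
  · set T := insert e S \ Finset.univ.image fun i => q (.inl i) with hT
    have hTS : T ⊆ S := by
      intro x hx
      rw [hT, Finset.mem_sdiff, Finset.mem_insert] at hx
      rcases hx.1 with rfl | h
      · exact absurd (Finset.mem_image.2 ⟨i₀, Finset.mem_univ _, hi₀⟩) hx.2
      · exact h
    -- Since `T` avoids the left ends, breaking pairs within `T` does not depend on their labels.
    have h := card_filter_forall_eq_mul_pow_le hL hq (Q := BreaksPairsWithin p T)
      (fun c i x hc => hc.congr fun y hy => by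
        rw [Function.update_of_ne]
        rintro rfl
        exact (Finset.mem_sdiff.1 hy).2 (Finset.mem_image.2 ⟨i, Finset.mem_univ _, rfl⟩))
      Finset.univ
    rw [Finset.card_univ] at h
    refine le_trans (Nat.mul_le_mul_right _ (Finset.card_le_card ?_)) h
    intro c hc
    simp only [Finset.mem_filter, Finset.mem_univ, forall_const] at hc ⊢
    exact ⟨hc.1, hc.2.1.mono hTS, hc.2.2⟩

/-- Iterates the one-element inequality along `B`. Requiring it only for sets smaller than `n` makes
the lemma usable as an induction hypothesis. -/
theorem pow_mul_countBreaking_le [Fintype E] [DecidableEq E] {L : E → Finset α} {r : ℕ} {β : ℝ}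
    (hβ : 0 < β)
    (p : I → ι ⊕ ι → E) {n : ℕ}
    (H : ∀ S : Finset E, S.card < n → ∀ e, e ∉ S →
      β * countBreaking L p S ≤ r * countBreaking L p (insert e S)) (B : Finset E) :
    ∀ T : Finset E, Disjoint T B → (T ∪ B).card ≤ n →
      β ^ B.card * countBreaking L p T ≤ r ^ B.card * countBreaking L p (T ∪ B) := by
  induction B using Finset.induction_on with
  | empty => intro T _ _; simp
  | insert b B hb ih =>
    intro T hd hc
    rw [Finset.disjoint_insert_right] at hd
    have hbn : b ∉ T ∪ B := by simp [hd.1, hb]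
    have hun : T ∪ insert b B = insert b (T ∪ B) := Finset.union_insert b T B
    rw [hun, Finset.card_insert_of_notMem hbn] at hc
    rw [hun, Finset.card_insert_of_notMem hb, pow_succ', pow_succ']
    calc β * β ^ B.card * countBreaking L p T = β * (β ^ B.card * countBreaking L p T) := by ring
      _ ≤ β * (r ^ B.card * countBreaking L p (T ∪ B)) :=
        mul_le_mul_of_nonneg_left (ih T hd.2 (by omega)) hβ.le
      _ = r ^ B.card * (β * countBreaking L p (T ∪ B)) := by ring
      _ ≤ r ^ B.card * (r * countBreaking L p (insert b (T ∪ B))) :=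
        mul_le_mul_of_nonneg_left (H _ (by omega) b hbn) (by positivity)
      _ = _ := by ring

open Classical in
theorem countBreaking_le_add_sum [Fintype E] [Fintype ι] (L : E → Finset α)
    (p : I → ι ⊕ ι → E) (S : Finset E) (e : E) {F : Finset I}
    (hF : ∀ f, (∃ j, p f j = e) → (∀ j, p f j ∈ insert e S) → f ∈ F) :
    countBreaking L p S ≤ countBreaking L p (insert e S) +
      ∑ f ∈ F, ((Fintype.piFinset L).filter fun c => BreaksPairsWithin p S c ∧
          ∀ i, c (p f (.inl i)) = c (p f (.inr i))).card := by
  refine le_trans (Finset.card_le_card (t := (Fintype.piFinset L).filter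
    (BreaksPairsWithin p (insert e S)) ∪ F.biUnion fun f => (Fintype.piFinset L).filter fun c =>
        BreaksPairsWithin p S c ∧ ∀ i, c (p f (.inl i)) = c (p f (.inr i))) ?_) ?_
  · intro c hc
    rw [Finset.mem_filter] at hc
    rw [Finset.mem_union, Finset.mem_filter]
    by_cases h : BreaksPairsWithin p (insert e S) c
    · exact Or.inl ⟨hc.1, h⟩
    · right
      unfold BreaksPairsWithin at h
      push Not at h
      obtain ⟨f, hf, hcf⟩ := h
      refine Finset.mem_biUnion.2 ⟨f, hF f ?_ hf,
        Finset.mem_filter.2 ⟨hc.1, hc.2, hcf⟩⟩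
      by_contra! hne
      obtain ⟨i, hi⟩ := hc.2 f fun j => (Finset.mem_insert.1 (hf j)).resolve_left (hne j)
      exact hi (hcf i)
  · exact (Finset.card_union_le _ _).trans (Nat.add_le_add_left Finset.card_biUnion_le _)

open Classical in
theorem mul_countBreaking_le [Fintype E] [Fintype ι] {L : E → Finset α} {r m : ℕ}
    {β : ℝ} (hr : 0 < r) (hβ : 0 < β) {p : I → ι ⊕ ι → E} {n : ℕ} (hn : Fintype.card ι = n + 1)
    (hL : ∀ e, (L e).card = r) (hp : ∀ f, Function.Injective (p f))
    (hm : ∀ e, ∃ D : Finset I, D.card ≤ m ∧ ∀ f j, p f j = e → f ∈ D)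
    (hrβ : β + m / β ^ n ≤ r) (S : Finset E) (e : E) (he : e ∉ S) :
    β * countBreaking L p S ≤ r * countBreaking L p (insert e S) := by
  induction hs : S.card using Nat.strong_induction_on generalizing S e with
  | _ s ih =>
  have hr' : (0 : ℝ) < r := by exact_mod_cast hr
  obtain ⟨D, hDm, hD⟩ := hm e
  set F := D.filter fun f => (∃ j, p f j = e) ∧ ∀ j, p f j ∈ insert e S with hF
  have hbad : ∀ f ∈ F, (((Fintype.piFinset L).filter fun c => BreaksPairsWithin p S c ∧
      ∀ i, c (p f (.inl i)) = c (p f (.inr i))).card : ℝ) ≤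
        countBreaking L p S / (r * β ^ n) := by
    intro f hf
    obtain ⟨-, ⟨j, hj⟩, hfS⟩ := Finset.mem_filter.1 hf
    obtain ⟨A, hA, heA, hAc, hle⟩ :=
      card_breaking_forall_eq_mul_pow_le hL p (hp f) hfS hj
    have hdisj : Disjoint (insert e S \ A) (A.erase e) :=
      Finset.disjoint_of_subset_right (Finset.erase_subset _ _) Finset.sdiff_disjoint
    have hunion : insert e S \ A ∪ A.erase e = S := by
      ext x
      simp only [Finset.mem_union, Finset.mem_sdiff, Finset.mem_insert, Finset.mem_erase]
      have := @hA x
      rw [Finset.mem_insert] at this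
      constructor
      · rintro (⟨rfl | h, h'⟩ | ⟨h, h'⟩)
        · exact absurd heA h'
        · exact h
        · exact (this h').resolve_left h
      · intro hx
        have hxe : x ≠ e := fun h => he (h ▸ hx)
        tauto
    have hcard : (A.erase e).card = n := by
      rw [Finset.card_erase_of_mem heA, hAc, hn]; rfl
    -- Restoring the `n` elements of `A` other than `e` leads back to `S` through strictly smaller
    -- sets, at a cost of `r / β` each.
    have hpow := pow_mul_countBreaking_le (L := L) (r := r) hβ p (n := s)
      (fun S' hS' e' he' => ih _ hS' S' e' he' rfl) (A.erase e) _ hdisj (by rw [hunion, hs])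
    rw [hunion, hcard] at hpow
    rw [hn] at hle
    have hle' : (((Fintype.piFinset L).filter fun c => BreaksPairsWithin p S c ∧
      ∀ i, c (p f (.inl i)) = c (p f (.inr i))).card : ℝ) * r ^ (n + 1) ≤
        countBreaking L p (insert e S \ A) := by exact_mod_cast hle
    rw [le_div_iff₀ (by positivity)]
    refine le_of_mul_le_mul_right ?_ (pow_pos hr' n)
    calc _ = β ^ n * ((((Fintype.piFinset L).filter fun c => BreaksPairsWithin p S c ∧
          ∀ i, c (p f (.inl i)) = c (p f (.inr i))).card : ℝ) * r ^ (n + 1)) := by ring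
      _ ≤ β ^ n * countBreaking L p (insert e S \ A) := by gcongr
      _ ≤ _ := by rw [mul_comm (countBreaking L p S : ℝ)]; exact hpow
  have hsum : (countBreaking L p S : ℝ) ≤ countBreaking L p (insert e S) +
      ∑ f ∈ F, (((Fintype.piFinset L).filter fun c => BreaksPairsWithin p S c ∧
        ∀ i, c (p f (.inl i)) = c (p f (.inr i))).card : ℝ) := by
    exact_mod_cast countBreaking_le_add_sum L p S e (F := F) fun f hf hfS =>
      Finset.mem_filter.2 ⟨hf.elim (hD f), hf, hfS⟩
  have hFm : (F.card : ℝ) ≤ m := Nat.cast_le.2 ((Finset.card_filter_le _ _).trans hDm)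
  have hsum' : (countBreaking L p S : ℝ) ≤ countBreaking L p (insert e S) +
      m * (countBreaking L p S / (r * β ^ n)) := by
    refine hsum.trans (add_le_add_right ((Finset.sum_le_sum hbad).trans ?_) _)
    rw [Finset.sum_const, nsmul_eq_mul]
    gcongr
  have h1 : (r : ℝ) * (m * (countBreaking L p S / (r * β ^ n))) =
      m / β ^ n * countBreaking L p S := by
    field_simp
  have h2 := mul_le_mul_of_nonneg_left hsum' hr'.le
  have h3 := mul_le_mul_of_nonneg_right hrβ (Nat.cast_nonneg (α := ℝ) (countBreaking L p S))
  rw [mul_add, h1] at h2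
  linarith

open Classical in
/-- If each element lies in at most `m` systems of `n + 1` disjoint pairs, then lists of size at
least `β + m / β ^ n` allow a labeling for which no system has all its pairs monochromatic. -/
theorem exists_labeling_breaking_pairs [Fintype E] [Fintype ι] {L : E → Finset α}
    {r m : ℕ} {β : ℝ} (hr : 0 < r) (hβ : 0 < β) {p : I → ι ⊕ ι → E} {n : ℕ}
    (hn : Fintype.card ι = n + 1)
    (hL : ∀ e, r ≤ (L e).card) (hp : ∀ f, Function.Injective (p f))
    (hm : ∀ e, ∃ D : Finset I, D.card ≤ m ∧ ∀ f j, p f j = e → f ∈ D)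
    (hrβ : β + m / β ^ n ≤ r) :
    ∃ c : E → α, (∀ e, c e ∈ L e) ∧ ∀ f, ∃ i, c (p f (.inl i)) ≠ c (p f (.inr i)) := by
  -- The count needs lists of exactly `r` labels, so the lists are trimmed.
  choose M hML hM using fun e => Finset.exists_subset_card_eq (hL e)
  have hpos : 0 < countBreaking M p ∅ := by
    have : Nonempty ι := Fintype.card_pos_iff.1 (by omega)
    have hne : (Fintype.piFinset M).Nonempty := by
      rw [Fintype.piFinset_nonempty]
      exact fun e => Finset.card_pos.1 (by rw [hM]; exact hr)
    obtain ⟨c, hc⟩ := hne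
    refine Finset.card_pos.2 ⟨c, Finset.mem_filter.2 ⟨hc, fun f hf => ?_⟩⟩
    exact absurd (hf (.inl (Classical.arbitrary ι))) (Finset.notMem_empty _)
  have hmain := pow_mul_countBreaking_le (L := M) (r := r) hβ p (n := Fintype.card E)
    (fun S _ e he => mul_countBreaking_le hr hβ hn hM hp hm hrβ S e he) Finset.univ ∅
    (Finset.disjoint_empty_left _) (Finset.card_le_univ _)
  rw [Finset.empty_union] at hmain
  have hpos' : (0 : ℝ) < r ^ (Finset.univ : Finset E).card * countBreaking M p Finset.univ :=
    lt_of_lt_of_le (mul_pos (pow_pos hβ _) (by exact_mod_cast hpos)) hmain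
  have hcount : 0 < countBreaking M p Finset.univ := by
    by_contra h
    rw [Nat.eq_zero_of_not_pos h] at hpos'
    simp at hpos'
  obtain ⟨c, hc⟩ := Finset.card_pos.1 hcount
  rw [Finset.mem_filter, Fintype.mem_piFinset] at hc
  exact ⟨c, fun e => hML e (hc.1 e), fun f => hc.2 f fun _ => Finset.mem_univ _⟩

end PairSystems

/-! ### Edge pairs arising from equal label sequences -/

section Graph

variable {V : Type*}

theorem mem_incidentEdges [Finite V] {G : SimpleGraph V} {v : V} {e : G.edgeSet} :
    e ∈ incidentEdges G v ↔ v ∈ (e : Sym2 V) := by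
  simp [incidentEdges]

theorem card_incidentEdges [Fintype V] {G : SimpleGraph V} [DecidableRel G.Adj] (v : V) :
    (incidentEdges G v).card = G.degree v := by
  classical
  rw [← G.card_incidenceFinset_eq_degree,
    ← Finset.card_map (Function.Embedding.subtype (· ∈ G.edgeSet))]
  congr 1
  ext e
  simp [mem_incidentEdges, SimpleGraph.incidenceSet, and_comm]

/-- Equality of the label sequences at adjacent vertices of a regular graph forces `n` disjoint
pairs of edges to be monochromatic. -/
theorem exists_pairs_of_adj [Fintype V] {G : SimpleGraph V} [DecidableRel G.Adj] {n : ℕ}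
    (hG : G.IsRegularOfDegree (n + 1)) (ord : LinearOrder G.edgeSet) {u v : V} (huv : G.Adj u v) :
    ∃ q : Fin n ⊕ Fin n → G.edgeSet, Function.Injective q ∧
      (∀ j, u ∈ (q j : Sym2 V) ∨ v ∈ (q j : Sym2 V)) ∧
      ∀ {α : Type*} (c : G.edgeSet → α), labelSequence G ord c u = labelSequence G ord c v →
        ∀ i, c (q (.inl i)) = c (q (.inr i)) := by
  set lu := (incidentEdges G u).sort ord.le with hlu
  set lv := (incidentEdges G v).sort ord.le with hlv
  have hul : lu.length = n + 1 := by
    rw [hlu, Finset.length_sort, card_incidentEdges, hG u]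
  have hvl : lv.length = n + 1 := by
    rw [hlv, Finset.length_sort, card_incidentEdges, hG v]
  have hun : lu.Nodup := Finset.sort_nodup _ _
  have hvn : lv.Nodup := Finset.sort_nodup _ _
  have hum : ∀ e, e ∈ lu ↔ u ∈ (e : Sym2 V) := fun e => by
    rw [hlu, Finset.mem_sort, mem_incidentEdges]
  have hvm : ∀ e, e ∈ lv ↔ v ∈ (e : Sym2 V) := fun e => by
    rw [hlv, Finset.mem_sort, mem_incidentEdges]
  obtain ⟨i, hi, hie⟩ := List.getElem_of_mem
    ((hum ⟨s(u, v), huv⟩).2 (Sym2.mem_mk_left u v))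
  set i₀ : Fin (n + 1) := ⟨i, by omega⟩ with hi₀
  set a : Fin (n + 1) → G.edgeSet := fun x => lu[(x : ℕ)]'(by omega) with ha
  set b : Fin (n + 1) → G.edgeSet := fun x => lv[(x : ℕ)]'(by omega) with hb
  have hai : Function.Injective a := fun x y h =>
    Fin.ext ((hun.getElem_inj_iff).1 h)
  have hbi : Function.Injective b := fun x y h =>
    Fin.ext ((hvn.getElem_inj_iff).1 h)
  have hau : ∀ x, u ∈ (a x : Sym2 V) := fun x => (hum _).1 (List.getElem_mem _)
  have hbv : ∀ x, v ∈ (b x : Sym2 V) := fun x => (hvm _).1 (List.getElem_mem _)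
  have hai₀ : a i₀ = ⟨s(u, v), huv⟩ := hie
  have hab : ∀ x y, a (i₀.succAbove x) ≠ b y := by
    intro x y h
    have h1 : a (i₀.succAbove x) = ⟨s(u, v), huv⟩ := by
      apply Subtype.ext
      refine ((Sym2.mem_and_mem_iff huv.ne).1 ⟨hau _, ?_⟩)
      rw [h]
      exact hbv y
    exact Fin.succAbove_ne i₀ x (hai (h1.trans hai₀.symm))
  -- The position of `uv` at `u` is dropped on both sides. The edge `uv` may remain among the `b`'s,
  -- which is harmless as it is the only edge common to both vertices.
  refine ⟨Sum.elim (fun x => a (i₀.succAbove x)) fun x => b (i₀.succAbove x), ?_, ?_, ?_⟩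
  · exact (hai.comp Fin.succAbove_right_injective).sumElim
      (hbi.comp Fin.succAbove_right_injective) fun x y => hab x _
  · rintro (x | x)
    · exact Or.inl (hau _)
    · exact Or.inr (hbv _)
  · intro α c hc x
    have hc' : lu.map c = lv.map c := hc
    have h := List.getElem_of_eq hc' (i := (i₀.succAbove x : ℕ)) (by
      rw [List.length_map]; omega)
    simpa using h

theorem exists_pairs_of_edge [Fintype V] {G : SimpleGraph V} [DecidableRel G.Adj] {n : ℕ}
    (hG : G.IsRegularOfDegree (n + 1)) (ord : LinearOrder G.edgeSet) (α : Type*)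
    (f : G.edgeSet) :
    ∃ q : Fin n ⊕ Fin n → G.edgeSet, Function.Injective q ∧
      (∀ j, ∃ w ∈ (q j : Sym2 V), w ∈ (f : Sym2 V)) ∧
      ∀ (c : G.edgeSet → α) (u v : V), (f : Sym2 V) = s(u, v) →
        labelSequence G ord c u = labelSequence G ord c v →
        ∀ i, c (q (.inl i)) = c (q (.inr i)) := by
  obtain ⟨f, hf⟩ := f
  induction f using Sym2.ind with
  | _ x y =>
  obtain ⟨q, hq, hqm, hqc⟩ := exists_pairs_of_adj hG ord (G.mem_edgeSet.1 hf)
  refine ⟨q, hq, fun j => ?_, fun c u v huv h => hqc c ?_⟩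
  · rcases hqm j with h | h
    · exact ⟨x, h, Sym2.mem_mk_left x y⟩
    · exact ⟨y, h, Sym2.mem_mk_right x y⟩
  · rcases Sym2.eq_iff.1 huv with ⟨rfl, rfl⟩ | ⟨rfl, rfl⟩
    · exact h
    · exact h.symm

theorem exists_distinguishing_labeling [Fintype V] {G : SimpleGraph V} [DecidableRel G.Adj]
    {n r : ℕ} {β : ℝ} (hG : G.IsRegularOfDegree (n + 2)) (ord : LinearOrder G.edgeSet)
    {α : Type*} {L : G.edgeSet → Finset α} (hr : 0 < r) (hβ : 0 < β)
    (hrβ : β + (2 * (n + 2) : ℕ) / β ^ n ≤ r) (hL : ∀ e, r ≤ (L e).card) :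
    ∃ c : G.edgeSet → α, (∀ e, c e ∈ L e) ∧ DistinguishesNeighborsBySequences G ord c := by
  classical
  choose p hp hpm hpc using exists_pairs_of_edge hG ord α
  obtain ⟨c, hcL, hc⟩ := exists_labeling_breaking_pairs (p := p) (m := 2 * (n + 2)) hr hβ
    (Fintype.card_fin (n + 1)) hL hp (by
      rintro ⟨e, he⟩
      induction e using Sym2.ind with
      | _ x y =>
      -- A system containing `xy` is indexed by an edge meeting `xy`, hence the bound of twice the
      -- degree.
      refine ⟨incidentEdges G x ∪ incidentEdges G y, (Finset.card_union_le _ _).trans ?_,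
        fun f j hj => ?_⟩
      · rw [card_incidentEdges, card_incidentEdges, hG, hG]
        omega
      · obtain ⟨w, hw, hwf⟩ := hpm f j
        rw [hj] at hw
        rw [Finset.mem_union, mem_incidentEdges, mem_incidentEdges]
        rcases Sym2.mem_iff.1 hw with rfl | rfl
        · exact Or.inl hwf
        · exact Or.inr hwf) hrβ
  refine ⟨c, hcL, fun u v huv h => ?_⟩
  obtain ⟨i, hi⟩ := hc ⟨s(u, v), huv⟩
  exact hi (hpc _ c u v rfl h i)

end Graph

/-! ### Numerical estimates for the list size -/

section Bound

/-- The ratio of consecutive bases is `1 + 1 / (n² - 1)`; by Bernoulli its `n`-th power is at least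
`1 + n / (n² - 1) ≥ (n + 1) / n`. -/
theorem div_sub_one_pow_antitone {n : ℕ} (hn : 2 ≤ n) :
    (((n + 1 : ℕ) : ℝ) / ((n + 1 : ℕ) - 1)) ^ (n + 1) ≤ ((n : ℝ) / (n - 1)) ^ n := by
  have hn' : (2 : ℝ) ≤ n := by exact_mod_cast hn
  have h1 : (0 : ℝ) < n - 1 := by linarith
  have hB := one_add_mul_le_pow (a := (1 : ℝ) / ((n - 1) * (n + 1)))
    (by have : (0 : ℝ) ≤ 1 / ((n - 1) * (n + 1)) := by positivity
        linarith) n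
  have h2 : ((n : ℝ) + 1) / n ≤ (1 + 1 / ((n - 1) * (n + 1))) ^ n := by
    refine le_trans ?_ hB
    rw [mul_one_div, ← sub_nonneg]
    have : 1 + (n : ℝ) / ((n - 1) * (n + 1)) - (n + 1) / n = 1 / (n * ((n - 1) * (n + 1))) := by
      field_simp
      ring
    rw [this]
    positivity
  have h3 : (n : ℝ) / (n - 1) = (n + 1) / n * (1 + 1 / ((n - 1) * (n + 1))) := by
    field_simp
    ring
  have h4 : (((n + 1 : ℕ) : ℝ) / ((n + 1 : ℕ) - 1)) = (n + 1) / n := by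
    push_cast
    rw [add_sub_cancel_right]
  rw [h4, h3, mul_pow, pow_succ]
  gcongr

theorem div_sub_one_pow_le {m n : ℕ} (hm : 2 ≤ m) (hmn : m ≤ n) :
    ((n : ℝ) / (n - 1)) ^ n ≤ ((m : ℝ) / (m - 1)) ^ m := by
  induction n, hmn using Nat.le_induction with
  | base => exact le_rfl
  | succ n hn ih => exact (div_sub_one_pow_antitone (hm.trans hn)).trans ih

theorem rpow_bound_lt {n : ℕ} (hn : 2 ≤ n) {b : ℝ} (hb : 0 < b)
    (h : ((n : ℝ) / (n - 1)) ^ n * (2 * ((n : ℝ) ^ 2 - 1)) < b ^ n) :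
    (((n + 1 : ℕ) : ℝ) - 1) / (((n + 1 : ℕ) : ℝ) - 2) *
      (2 * ((n + 1 : ℕ) : ℝ) ^ 2 - 4 * ((n + 1 : ℕ) : ℝ)) ^ (1 / (((n + 1 : ℕ) : ℝ) - 1)) < b := by
  have hn' : (2 : ℝ) ≤ n := by exact_mod_cast hn
  have h1 : (0 : ℝ) < n - 1 := by linarith
  have e1 : ((n + 1 : ℕ) : ℝ) - 1 = n := by push_cast; ring
  have e2 : ((n + 1 : ℕ) : ℝ) - 2 = n - 1 := by push_cast; ring
  have e3 : 2 * ((n + 1 : ℕ) : ℝ) ^ 2 - 4 * ((n + 1 : ℕ) : ℝ) = 2 * ((n : ℝ) ^ 2 - 1) := by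
    push_cast; ring
  rw [e1, e2, e3]
  refine lt_of_pow_lt_pow_left₀ n hb.le ?_
  rw [mul_pow, one_div, Real.rpow_inv_natCast_pow (by nlinarith) (by omega)]
  exact h

theorem sequenceListBound_le_three {k : ℕ} (hk : 6 ≤ k) : sequenceListBound k ≤ 3 := by
  obtain ⟨n, rfl⟩ : ∃ n, k = n + 1 := ⟨k - 1, by omega⟩
  have hn : 5 ≤ n := by omega
  -- The factor `1 / 5` suffices because `(5 / 4) ^ 5 < 5`.
  have hpow : (100 : ℝ) * (2 * ((n : ℝ) ^ 2 - 1)) ≤ 20 * 3 ^ n := by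
    induction n, hn using Nat.le_induction with
    | base => norm_num
    | succ m hm ih =>
      have hm' : (5 : ℝ) ≤ m := by exact_mod_cast hm
      have := ih (by omega)
      push_cast
      rw [pow_succ (3 : ℝ)]
      nlinarith
  have h := rpow_bound_lt (n := n) (b := 3) (by omega) (by norm_num) (by
    have h1 := div_sub_one_pow_le (m := 5) (by norm_num) hn
    have hn' : (5 : ℝ) ≤ n := by exact_mod_cast hn
    have h2 : (0 : ℝ) < 2 * ((n : ℝ) ^ 2 - 1) := by nlinarith
    have h3 : (0 : ℝ) < 3 ^ n := by positivity
    have h4 := mul_le_mul_of_nonneg_right h1 h2.le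
    norm_num at h4 h1 ⊢
    nlinarith)
  have := (Nat.floor_lt' (by norm_num)).2 (h.trans_eq (by norm_num : (3 : ℝ) = (3 : ℕ)))
  unfold sequenceListBound
  omega

theorem sequenceListBound_eq_two {k : ℕ} (hk : 10 ≤ k) : sequenceListBound k = 2 := by
  obtain ⟨n, rfl⟩ : ∃ n, k = n + 1 := ⟨k - 1, by omega⟩
  have hn : 9 ≤ n := by omega
  have hn' : (9 : ℝ) ≤ n := by exact_mod_cast hn
  have h2 : (0 : ℝ) < 2 * ((n : ℝ) ^ 2 - 1) := by nlinarith
  -- Equality at `n = 9`; the slack needed later is `(9 / 8) ^ 9 < 512 / 160`.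
  have hpow : (2 * ((n : ℝ) ^ 2 - 1)) * 512 ≤ 160 * 2 ^ n := by
    clear h2 hn' hk
    induction n, hn using Nat.le_induction with
    | base => norm_num
    | succ m hm ih =>
      have hm' : (9 : ℝ) ≤ m := by exact_mod_cast hm
      push_cast
      rw [pow_succ (2 : ℝ)]
      nlinarith
  have h := rpow_bound_lt (n := n) (b := 2) (by omega) (by norm_num) (by
    have h1 := div_sub_one_pow_le (m := 9) (by norm_num) hn
    have h3 : (0 : ℝ) < 2 ^ n := by positivity
    have h4 := mul_le_mul_of_nonneg_right h1 h2.le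
    norm_num at h4 h1 ⊢
    nlinarith)
  have hlt := (Nat.floor_lt' (by norm_num)).2 (h.trans_eq (by norm_num : (2 : ℝ) = (2 : ℕ)))
  have hone : 1 ≤ ⌊(((n + 1 : ℕ) : ℝ) - 1) / (((n + 1 : ℕ) : ℝ) - 2) *
      (2 * ((n + 1 : ℕ) : ℝ) ^ 2 - 4 * ((n + 1 : ℕ) : ℝ)) ^ (1 / (((n + 1 : ℕ) : ℝ) - 1))⌋₊ := by
    refine Nat.le_floor ?_
    push_cast
    refine one_le_mul_of_one_le_of_one_le ?_ (Real.one_le_rpow ?_ ?_)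
    · rw [one_le_div (by linarith)]
      linarith
    · nlinarith
    · exact one_div_nonneg.2 (by linarith)
  unfold sequenceListBound
  omega

/-- With `k = n + 2`, the minimizer of `β + 2k / β ^ n` satisfies `β ^ (n + 1) = 2kn`, and the
minimum is `β + β / n`. -/
theorem exists_add_div_pow_le_sequenceListBound (n : ℕ) (hn : 1 ≤ n) :
    ∃ β : ℝ, 0 < β ∧ β + (2 * (n + 2) : ℕ) / β ^ n ≤ sequenceListBound (n + 2) := by
  have hn' : (1 : ℝ) ≤ n := by exact_mod_cast hn
  have e1 : ((n + 2 : ℕ) : ℝ) - 1 = (n + 1 : ℕ) := by push_cast; ring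
  have e2 : ((n + 2 : ℕ) : ℝ) - 2 = n := by push_cast; ring
  have e3 : 2 * ((n + 2 : ℕ) : ℝ) ^ 2 - 4 * ((n + 2 : ℕ) : ℝ) = 2 * (n + 2) * n := by
    push_cast; ring
  have hpos : (0 : ℝ) < 2 * (n + 2) * n := by positivity
  refine ⟨(2 * (n + 2) * n : ℝ) ^ (1 / ((n + 1 : ℕ) : ℝ)), Real.rpow_pos_of_pos hpos _, ?_⟩
  have hfloor : ∀ x : ℝ, x ≤ (1 + ⌊x⌋₊ : ℕ) := fun x => by
    push_cast
    linarith [Nat.lt_floor_add_one x]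
  unfold sequenceListBound
  refine le_trans (le_of_eq ?_) (hfloor _)
  rw [e1, e2, e3]
  set β := (2 * (n + 2) * n : ℝ) ^ (1 / ((n + 1 : ℕ) : ℝ)) with hβ
  have hβ0 : 0 < β := Real.rpow_pos_of_pos hpos _
  have hβn : β ^ n * β = 2 * (n + 2) * n := by
    rw [← pow_succ, hβ, one_div, Real.rpow_inv_natCast_pow hpos.le (by omega)]
  have hq : ((2 * (n + 2) : ℕ) : ℝ) / β ^ n = β / n := by
    rw [div_eq_div_iff (by positivity) (by positivity), mul_comm β, hβn]
    push_cast
    ring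
  rw [hq]
  push_cast
  field_simp

end Bound

theorem corollary4p9 :
    (∀ (k : ℕ), 3 ≤ k →
      ∀ (V : Type*) [Fintype V] (G : SimpleGraph V) [DecidableRel G.Adj],
        G.IsRegularOfDegree k →
      ∀ (ord : LinearOrder G.edgeSet) (α : Type*) (L : G.edgeSet → Finset α),
        (∀ e, sequenceListBound k ≤ (L e).card) →
        ∃ c : G.edgeSet → α, (∀ e, c e ∈ L e) ∧ DistinguishesNeighborsBySequences G ord c) ∧
    (∀ k : ℕ, 6 ≤ k → sequenceListBound k ≤ 3) ∧
    (∀ k : ℕ, 10 ≤ k → sequenceListBound k = 2) := by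
  refine ⟨?_, fun k => sequenceListBound_le_three, fun k => sequenceListBound_eq_two⟩
  intro k hk V _ G _ hG ord α L hL
  obtain ⟨n, rfl⟩ : ∃ n, k = n + 2 := ⟨k - 2, by omega⟩
  obtain ⟨β, hβ, hrβ⟩ := exists_add_div_pow_le_sequenceListBound n (by omega)
  refine exists_distinguishing_labeling hG ord ?_ hβ hrβ hL
  unfold sequenceListBound
  omega
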